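/- Let $n\ge 1$, let $I_{[n]}=\{0,1\}^n$, and for $\mathbf i\in I_{[n]}$ let $\bar{\mathbf i}$ be the index obtained by switching every digit of $\mathbf i$. Let $\mathcal V_n^{\mathrm{sa}}$ be the real vector space of functions $u:I_{[n]}\to\mathbb C$ with $u_{\bar{\mathbf i}}=\overline{u_{\mathbf i}}$ for all $\mathbf i$. For $a:I_{[n]}\to[0,\infty)$ and $c\in\mathcal V_n^{\mathrm{sa}}$, let $X(a,c)\in M_2(\mathbb C)^{\otimes n}$ be the matrix, with rows and columns indexed by $I_{[n]}$, whose $(\mathbf i,\mathbf i)$ entry is $a_{\mathbf i}$, whose $(\mathbf i,\bar{\mathbf i})$ entry is $c_{\mathbf i}$, and whose other entries are $0$. For $u,c\in\mathcal V_n^{\mathrm{sa}}$ put $$\langle u,c\rangle=\sum_{\mathbf i\in I_{[n]}}u_{\mathbf i}c_{\mathbf i}\in\mathbb R,\qquad \|u\|_{X_n}=\sup_{\alpha\in\mathbb T^n}\ \sum_{\mathbf i\in I_{[n]}}u_{\mathbf i}\prod_{k=1}^n\alpha_k^{\,1-2\mathbf i(k)},\qquad \|c\|'_{X_n}=\sup\{\langle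 u,c\rangle:\ u\in\mathcal V_n^{\mathrm{sa}},\ \|u\|_{X_n}=1\},$$ where $\mathbb T$ is the unit circle in $\mathbb C$. An $n$-qubit state is a positive semidefinite matrix in $M_2(\mathbb C)^{\otimes n}$ (not necessarily of trace one). It is separable if it is a finite sum, with nonnegative weights, of pure product states $|\xi\rangle\langle\xi|$ with $\xi=x_1\otimes\cdots\otimes x_n$ and unit vectors $x_k\in\mathbb C^2$ (for a state of trace one, this is a convex combination of pure product states). Suppose that $\varrho=X(a,c)$ is an $n$-qubit state with $a_{\mathbf i}=a_{\bar{\mathbf i}}$ for every $\mathbf i\in I_{[n]}$. Then $\varrho$ is separable if and only if $$\min_{\mathbf i\in I_{[n]}}a_{\mathbf i}\ \ge\ \|c\|'_{X_n}.$$ -/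

import Mathlib

noncomputable section

namespace MultiQubit

/-- The set `I_[n]` of indices, that is, strings of `n` binary digits. -/
abbrev Idx (n : ℕ) : Type := Fin n → Fin 2

/-- The index `ī` obtained from `i` by switching every digit (addition in `Fin 2` is mod 2). -/
def flip {n : ℕ} (i : Idx n) : Idx n := fun k => i k + 1

/-- Nonnegative functions on the set of indices. -/
def VPlus (n : ℕ) : Set (Idx n → ℝ) := {s | ∀ i, 0 ≤ s i}

/-- Complex functions `u` on the set of indices such that `u ī` is the conjugate of `u i`. -/
def VSa (n : ℕ) : Set (Idx n → ℂ) := {u | ∀ i, u (flip i) = star (u i)}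

/-- The X-shaped matrix `X(s,u)`, where the `n`-fold tensor product of the `2 × 2` matrices is
identified with the matrices indexed by `Idx n`. -/
def X {n : ℕ} (s : Idx n → ℝ) (u : Idx n → ℂ) : Matrix (Idx n) (Idx n) ℂ :=
  Matrix.of fun i j => if j = i then (s i : ℂ) else if j = flip i then u i else 0

/-- The monomial `α ^ i = ∏ k, α_k ^ (1 - 2 i(k))` for `α` in the `n`-torus. -/
def monomial {n : ℕ} (α : Fin n → Circle) (i : Idx n) : Circle :=
  ∏ k, α k ^ (1 - 2 * ((i k : ℕ) : ℤ))

/-- The bilinear pairing `∑ i, u i * c i`. It is a real number when `u` and `c` lie in `VSa n`,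
so that taking the real part only serves to land in `ℝ`. -/
def pairing {n : ℕ} (u c : Idx n → ℂ) : ℝ := (∑ i, u i * c i).re

/-- The norm `‖u‖_{X_n} = sup_α ∑ i, u i * α ^ i`, the supremum over the `n`-torus; the sum is
real when `u` lies in `VSa n`. -/
def xNorm {n : ℕ} (u : Idx n → ℂ) : ℝ :=
  ⨆ α : Fin n → Circle, pairing u fun i => (monomial α i : ℂ)

/-- The dual norm `‖c‖'_{X_n} = sup {⟨u, c⟩ : u ∈ VSa n, ‖u‖_{X_n} = 1}`. -/
def xDualNorm {n : ℕ} (c : Idx n → ℂ) : ℝ :=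
  sSup {t : ℝ | ∃ u ∈ VSa n, xNorm u = 1 ∧ t = pairing u c}

/-- The coordinates of the product vector `x_1 ⊗ ⋯ ⊗ x_n`. -/
def productVector {n : ℕ} (x : Fin n → EuclideanSpace ℂ (Fin 2)) : Idx n → ℂ :=
  fun i => ∏ k, x k (i k)

/-- The rank one matrix `|ξ⟩⟨ξ|` of the product vector `ξ = x_1 ⊗ ⋯ ⊗ x_n`. -/
def productState {n : ℕ} (x : Fin n → EuclideanSpace ℂ (Fin 2)) : Matrix (Idx n) (Idx n) ℂ :=
  Matrix.vecMulVec (productVector x) (star (productVector x))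

open scoped ComplexOrder in
/-- An `n`-qubit state, not necessarily normalized: a positive semidefinite matrix. -/
def IsState {n : ℕ} (ρ : Matrix (Idx n) (Idx n) ℂ) : Prop := ρ.PosSemidef

/-- (Full) separability: `ρ` is a finite sum, with nonnegative weights, of pure product states.
The pure product states have trace one, so that the weights sum to the trace of `ρ`; when `ρ` has
trace one, this says that `ρ` is a convex combination of pure product states. -/
def IsSeparable {n : ℕ} (ρ : Matrix (Idx n) (Idx n) ℂ) : Prop :=
  ∃ (m : ℕ) (p : Fin m → ℝ) (x : Fin m → Fin n → EuclideanSpace ℂ (Fin 2)),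
    (∀ j, 0 ≤ p j) ∧ (∀ j k, ‖x j k‖ = 1) ∧ ρ = ∑ j, p j • productState (x j)

end MultiQubit

end

/-! Up to scale, the antidiagonal of a product state is a monomial vector `monomialVec α`. So
separability asks whether `c` is a nonnegative combination of these vectors whose total weight the
diagonal can pay for.

Necessity: the scale `r` is the geometric mean of each pair of opposite diagonal entries, hence at
most their arithmetic mean (`exists_productState_flip_eq`). Pairing with `u` of norm one contributes
at most `r` per product state, and the symmetry of `a` turns the mean into `a i`.

Sufficiency: Hahn-Banach separation puts any `c` with dual norm at most `m` in `m` times the convex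
hull of the monomial vectors (`exists_mem_convexHull_of_xDualNorm_le`). Each `X 1 (monomialVec α)`
is separable (`X_one_monomialVec`). With `m` the least entry of `a`, the rest of `X a c` is a
nonnegative diagonal matrix. -/

/-- The convex hull of a compact set in a finite-dimensional space is compact. -/
theorem IsCompact.isCompact_convexHull {E : Type*} [NormedAddCommGroup E] [NormedSpace ℝ E]
    [FiniteDimensional ℝ E] {K : Set E} (hK : IsCompact K) : IsCompact (convexHull ℝ K) := by
  -- Carathéodory: boundedly many points suffice, so the hull is a finite union of continuous images
  -- of compact sets.
  have h : convexHull ℝ K = ⋃ l ∈ Set.Iic (Module.finrank ℝ E + 1),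
      (fun p : (Fin l → ℝ) × (Fin l → E) => ∑ j, p.1 j • p.2 j) ''
        (stdSimplex ℝ (Fin l) ×ˢ Set.univ.pi fun _ => K) := by
    refine Set.Subset.antisymm (fun v hv => ?_) (Set.iUnion₂_subset fun l _ => ?_)
    · obtain ⟨ι, _, z, w, hz, hind, hpos, hsum, rfl⟩ := eq_pos_convex_span_of_mem_convexHull hv
      let e := Fintype.equivFin ι
      refine Set.mem_biUnion (x := Fintype.card ι) ?_ ⟨(w ∘ e.symm, z ∘ e.symm), ⟨⟨?_, ?_⟩, ?_⟩, ?_⟩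
      · exact hind.card_le_finrank_succ.trans
          (Nat.succ_le_succ (Submodule.finrank_le _))
      · exact fun j => (hpos _).le
      · exact (e.symm.sum_comp w).trans hsum
      · exact fun j _ => hz (Set.mem_range_self _)
      · exact e.symm.sum_comp fun j => w j • z j
    · rintro _ ⟨⟨w, z⟩, ⟨⟨hw, hsum⟩, hz⟩, rfl⟩
      exact (convex_convexHull ℝ K).sum_mem (fun j _ => hw j) hsum
        fun j _ => subset_convexHull ℝ K (hz j trivial)
  rw [h]
  refine (Set.finite_Iic _).isCompact_biUnion fun l _ => ?_
  refine ((isCompact_stdSimplex ℝ (Fin l)).prod (isCompact_univ_pi fun _ => hK)).image ?_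
  fun_prop

theorem Circle.coe_finsetProd {ι : Type*} (s : Finset ι) (f : ι → Circle) :
    ((∏ k ∈ s, f k : Circle) : ℂ) = ∏ k ∈ s, (f k : ℂ) :=
  map_prod Circle.coeHom f s

namespace MultiQubit

open scoped Pointwise

variable {n : ℕ}

/-! ### The index involution and the monomials -/

theorem flip_flip (i : Idx n) : flip (flip i) = i := by
  funext k
  simp only [flip, add_assoc]
  exact add_zero _

theorem flip_ne (hn : 1 ≤ n) (i : Idx n) : flip i ≠ i := fun h => by
  simpa [flip] using congrFun h ⟨0, hn⟩

/-- Switching the digits, as a permutation of the indices. -/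
def flipEquiv (n : ℕ) : Idx n ≃ Idx n := ⟨flip, flip, flip_flip, flip_flip⟩

theorem sum_flip {M : Type*} [AddCommMonoid M] (f : Idx n → M) :
    ∑ i, f (flip i) = ∑ i, f i := (flipEquiv n).sum_comp f

theorem zpow_digit_succ {G : Type*} [Group G] (z : G) (b : Fin 2) :
    z ^ (1 - 2 * (((b + 1 : Fin 2) : ℕ) : ℤ)) = (z ^ (1 - 2 * ((b : ℕ) : ℤ)))⁻¹ := by
  fin_cases b <;> simp

theorem monomial_flip (α : Fin n → Circle) (i : Idx n) :
    monomial α (flip i) = (monomial α i)⁻¹ := by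
  simp only [monomial, flip, zpow_digit_succ, Finset.prod_inv_distrib]

/-- The monomials evaluated at a point of the torus, as a vector. -/
noncomputable def monomialVec (α : Fin n → Circle) : Idx n → ℂ := fun i => (monomial α i : ℂ)

theorem monomialVec_mem_VSa (α : Fin n → Circle) : monomialVec α ∈ VSa n := fun i => by
  rw [monomialVec, monomial_flip, Circle.coe_inv_eq_conj]
  rfl

theorem monomialVec_apply (α : Fin n → Circle) (i : Idx n) :
    monomialVec α i = ∏ k, ((α k ^ (1 - 2 * ((i k : ℕ) : ℤ)) : Circle) : ℂ) :=
  Circle.coe_finsetProd _ _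

theorem norm_monomialVec (α : Fin n → Circle) (i : Idx n) : ‖monomialVec α i‖ = 1 :=
  Circle.norm_coe _

theorem continuous_monomialVec : Continuous (monomialVec (n := n)) := by
  refine continuous_pi fun i => ?_
  have h : Continuous fun α : Fin n → Circle => monomial α i :=
    continuous_finsetProd _ fun k _ => (continuous_apply k).zpow _
  exact continuous_subtype_val.comp h

/-! ### The pairing and the two norms -/

theorem ofReal_pairing {u c : Idx n → ℂ} (hu : u ∈ VSa n) (hc : c ∈ VSa n) :
    (pairing u c : ℂ) = ∑ i, u i * c i := by
  rw [pairing, ← Complex.conj_eq_iff_re, map_sum]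
  rw [← sum_flip]
  refine Finset.sum_congr rfl fun i _ => ?_
  rw [hu i, hc i]
  simp

theorem abs_pairing_le (u c : Idx n → ℂ) : |pairing u c| ≤ ∑ i, ‖u i‖ * ‖c i‖ := by
  refine (Complex.abs_re_le_norm _).trans ((norm_sum_le _ _).trans ?_)
  simp

theorem pairing_smul_left (t : ℝ) (u c : Idx n → ℂ) :
    pairing (t • u) c = t * pairing u c := by
  simp only [pairing, Pi.smul_apply, smul_mul_assoc, ← Finset.smul_sum, Complex.smul_re, smul_eq_mul]

theorem pairing_smul_right (t : ℝ) (u c : Idx n → ℂ) :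
    pairing u (t • c) = t * pairing u c := by
  simp only [pairing, Pi.smul_apply, mul_smul_comm, ← Finset.smul_sum, Complex.smul_re, smul_eq_mul]

theorem pairing_monomialVec_le_xNorm (u : Idx n → ℂ) (α : Fin n → Circle) :
    pairing u (monomialVec α) ≤ xNorm u := by
  refine le_ciSup (f := fun α : Fin n → Circle => pairing u (monomialVec α)) ?_ α
  refine ⟨∑ i, ‖u i‖, ?_⟩
  rintro _ ⟨β, rfl⟩
  refine (le_abs_self _).trans ((abs_pairing_le _ _).trans ?_)
  simp [norm_monomialVec]

/-- Changing the sign of one coordinate changes the sign of all monomials. -/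
theorem exists_monomialVec_eq_neg (hn : 1 ≤ n) (α : Fin n → Circle) :
    ∃ β : Fin n → Circle, monomialVec β = -monomialVec α := by
  -- The circle element here is `conj I / I = -1`; every exponent is odd, so each monomial picks up
  -- exactly one sign.
  refine ⟨α * Pi.mulSingle ⟨0, hn⟩ (Circle.ofConjDivSelf Complex.I Complex.I_ne_zero), ?_⟩
  have hz : ((Circle.ofConjDivSelf Complex.I Complex.I_ne_zero : Circle) : ℂ) = -1 := by
    simp [Circle.ofConjDivSelf]
  funext i
  simp only [monomialVec_apply, Pi.mul_apply, mul_zpow, Circle.coe_mul, Finset.prod_mul_distrib,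
    Pi.neg_apply]
  rw [Finset.prod_eq_single (f := fun k => ((Pi.mulSingle (M := fun _ => Circle) _ _ k ^ _ : Circle) : ℂ))
    ⟨0, hn⟩, Pi.mulSingle_eq_same, Circle.coe_zpow, hz]
  · rw [(show Odd (1 - 2 * ((i ⟨0, hn⟩ : ℕ) : ℤ)) from ⟨-(i ⟨0, hn⟩ : ℕ), by ring⟩).neg_one_zpow]
    ring
  · intro k _ hk
    rw [Pi.mulSingle_eq_of_ne hk, one_zpow, Circle.coe_one]
  · simp

theorem abs_pairing_monomialVec_le_xNorm (hn : 1 ≤ n) (u : Idx n → ℂ) (α : Fin n → Circle) :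
    |pairing u (monomialVec α)| ≤ xNorm u := by
  refine abs_le'.2 ⟨pairing_monomialVec_le_xNorm u α, ?_⟩
  obtain ⟨β, hβ⟩ := exists_monomialVec_eq_neg hn α
  have h : pairing u (-monomialVec α) = -pairing u (monomialVec α) := by
    simpa using pairing_smul_right (-1) u (monomialVec α)
  rw [← h, ← hβ]
  exact pairing_monomialVec_le_xNorm u β

theorem sum_prod_digits {R : Type*} [CommSemiring R] (f : Fin n → Fin 2 → R) :
    ∑ d : Idx n, ∏ k, f k (d k) = ∏ k, (f k 0 + f k 1) := by
  simp only [← Fin.sum_univ_two, Finset.prod_univ_sum, Fintype.piFinset_univ]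

/-- The point of the torus whose coordinates are `1` or `I`, as prescribed by the digits of `d`. -/
noncomputable def quarterPoint (d : Idx n) : Fin n → Circle :=
  fun k => (Circle.exp (Real.pi / 2)) ^ ((d k : ℕ))

/-- Orthogonality of the monomials on the grid `{1, I}^n`: the sum factors over the digits, and a
digit where `i` and `j` differ gives `1 + I * I = 0` or its conjugate. This recovers coefficients
from finitely many values. -/
theorem sum_quarterPoint (i j : Idx n) :
    ∑ d : Idx n, monomialVec (quarterPoint d) i * star (monomialVec (quarterPoint d) j) =
      if i = j then 2 ^ n else 0 := by
  have hI : (Circle.exp (Real.pi / 2) : ℂ) = Complex.I := by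
    rw [Circle.coe_exp]; push_cast; exact Complex.exp_pi_div_two_mul_I
  have h : ∀ d : Idx n,
      monomialVec (quarterPoint d) i * star (monomialVec (quarterPoint d) j) =
      ∏ k, (fun k (b : Fin 2) => (Complex.I ^ (b : ℕ)) ^ (1 - 2 * ((i k : ℕ) : ℤ)) *
        star ((Complex.I ^ (b : ℕ)) ^ (1 - 2 * ((j k : ℕ) : ℤ)))) k (d k) := by
    intro d
    have hm : ∀ l : Idx n, monomialVec (quarterPoint d) l =
        ∏ k, (Complex.I ^ (d k : ℕ)) ^ (1 - 2 * ((l k : ℕ) : ℤ)) := by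
      intro l
      simp only [monomialVec_apply, quarterPoint, Circle.coe_zpow, Circle.coe_pow, hI]
    simp only [hm, star_prod, Finset.prod_mul_distrib]
  have h2 : ∀ a b : Fin 2, ((Complex.I ^ ((0 : Fin 2) : ℕ)) ^ (1 - 2 * ((a : ℕ) : ℤ)) *
        star ((Complex.I ^ ((0 : Fin 2) : ℕ)) ^ (1 - 2 * ((b : ℕ) : ℤ)))) +
      ((Complex.I ^ ((1 : Fin 2) : ℕ)) ^ (1 - 2 * ((a : ℕ) : ℤ)) *
        star ((Complex.I ^ ((1 : Fin 2) : ℕ)) ^ (1 - 2 * ((b : ℕ) : ℤ)))) =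
      if a = b then 2 else 0 := by
    intro a b
    fin_cases a <;> fin_cases b <;> norm_num
  rw [(Finset.sum_congr rfl fun d _ => h d).trans (sum_prod_digits fun k (b : Fin 2) =>
    (Complex.I ^ (b : ℕ)) ^ (1 - 2 * ((i k : ℕ) : ℤ)) *
      star ((Complex.I ^ (b : ℕ)) ^ (1 - 2 * ((j k : ℕ) : ℤ))))]
  simp only [h2]
  split_ifs with hij
  · simp [hij]
  · obtain ⟨k, hk⟩ := Function.ne_iff.1 hij
    exact Finset.prod_eq_zero (Finset.mem_univ k) (if_neg hk)

/-- The coefficients of a trigonometric polynomial are bounded by its norm. -/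
theorem norm_apply_le_xNorm (hn : 1 ≤ n) {u : Idx n → ℂ} (hu : u ∈ VSa n) (j : Idx n) :
    ‖u j‖ ≤ xNorm u := by
  have h : (2 : ℂ) ^ n * u j = ∑ d : Idx n,
      (pairing u (monomialVec (quarterPoint d)) : ℂ) * star (monomialVec (quarterPoint d) j) := by
    simp only [ofReal_pairing hu (monomialVec_mem_VSa _), Finset.sum_mul]
    rw [Finset.sum_comm]
    simp only [mul_assoc, ← Finset.mul_sum, sum_quarterPoint]
    simp [mul_comm]
  have h2 : (2 : ℝ) ^ n * ‖u j‖ ≤ 2 ^ n * xNorm u := by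
    calc (2 : ℝ) ^ n * ‖u j‖ = ‖(2 : ℂ) ^ n * u j‖ := by simp
      _ ≤ ∑ d : Idx n, xNorm u := by
        rw [h]
        refine (norm_sum_le _ _).trans (Finset.sum_le_sum fun d _ => ?_)
        rw [norm_mul, norm_star, norm_monomialVec, mul_one, Complex.norm_real]
        exact abs_pairing_monomialVec_le_xNorm hn u _
      _ = 2 ^ n * xNorm u := by simp
  exact le_of_mul_le_mul_left h2 (by positivity)

theorem xNorm_smul {t : ℝ} (ht : 0 ≤ t) (u : Idx n → ℂ) : xNorm (t • u) = t * xNorm u := by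
  simp only [xNorm, pairing_smul_left, Real.mul_iSup_of_nonneg ht]

theorem smul_mem_VSa (t : ℝ) {u : Idx n → ℂ} (hu : u ∈ VSa n) : t • u ∈ VSa n := fun i => by
  simp [hu i]

theorem pairing_le_xDualNorm_mul_xNorm (hn : 1 ≤ n) {u : Idx n → ℂ} (hu : u ∈ VSa n)
    (c : Idx n → ℂ) : pairing u c ≤ xDualNorm c * xNorm u := by
  -- Without boundedness `sSup` would take its default value `0`; the coefficient estimate supplies
  -- it.
  have hbdd : BddAbove {t : ℝ | ∃ u ∈ VSa n, xNorm u = 1 ∧ t = pairing u c} := by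
    refine ⟨∑ i, ‖c i‖, ?_⟩
    rintro _ ⟨v, hv, hv1, rfl⟩
    refine (le_abs_self _).trans ((abs_pairing_le _ _).trans (Finset.sum_le_sum fun i _ => ?_))
    exact mul_le_of_le_one_left (norm_nonneg _) (hv1 ▸ norm_apply_le_xNorm hn hv i)
  have h0 : 0 ≤ xNorm u := (norm_nonneg _).trans (norm_apply_le_xNorm hn hu fun _ => 0)
  rcases h0.eq_or_lt with h | h
  · have hz : u = 0 := funext fun i =>
      norm_le_zero_iff.1 ((norm_apply_le_xNorm hn hu i).trans h.ge)
    rw [← h, hz]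
    simp [pairing]
  · have := le_csSup hbdd ⟨(xNorm u)⁻¹ • u, smul_mem_VSa _ hu,
      by rw [xNorm_smul (inv_nonneg.2 h0), inv_mul_cancel₀ h.ne'], rfl⟩
    rw [pairing_smul_left, inv_mul_le_iff₀ h, mul_comm] at this
    exact this

/-! ### The ball of the dual norm -/

/-- A real functional is the real part of a complex bilinear pairing with some `w`. Averaging `w`
with its flipped conjugate lands in `VSa n` without changing the values on `VSa n`. -/
theorem exists_mem_VSa_pairing_eq (f : (Idx n → ℂ) →L[ℝ] ℝ) :
    ∃ u ∈ VSa n, ∀ c ∈ VSa n, pairing u c = f c := by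
  -- Chosen so that `(w i * z).re = z.re * f (e i) + z.im * f (I e i)`.
  let w : Idx n → ℂ := fun i => (f (Pi.single i 1) : ℂ) - f (Pi.single i Complex.I) * Complex.I
  have hf : ∀ c, f c = pairing w c := by
    intro c
    have hc : c = ∑ i, ((c i).re • (Pi.single i 1 : Idx n → ℂ) +
        (c i).im • (Pi.single i Complex.I : Idx n → ℂ)) := by
      funext j
      simp [Finset.sum_apply, Pi.single_apply, Finset.sum_add_distrib, Complex.re_add_im]
    conv_lhs => rw [hc]
    simp only [map_sum, map_add, map_smul, pairing, Complex.re_sum]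
    refine Finset.sum_congr rfl fun i _ => ?_
    simp [w]
    ring
  refine ⟨fun i => (1 / 2 : ℝ) • (w i + star (w (flip i))), fun i => ?_, fun c hc => ?_⟩
  · simp [flip_flip, add_comm]
  · have h : pairing (fun i => star (w (flip i))) c = pairing w c := by
      rw [pairing, pairing, ← sum_flip fun i => w i * c i, ← Complex.conj_re, map_sum]
      simp [hc _]
    have h2 : pairing (fun i => (1 / 2 : ℝ) • (w i + star (w (flip i)))) c =
        (1 / 2) * (pairing w c + pairing (fun i => star (w (flip i))) c) := by
      simp only [pairing, smul_mul_assoc, ← Finset.smul_sum, add_mul, Finset.sum_add_distrib,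
        Complex.smul_re, Complex.add_re, smul_eq_mul]
    rw [h2, h, hf]
    ring

/-- The ball of radius `m` of the dual norm is the convex hull of the monomial vectors,
scaled by `m`. -/
theorem exists_mem_convexHull_of_xDualNorm_le (hn : 1 ≤ n) {c : Idx n → ℂ} (hc : c ∈ VSa n)
    {m : ℝ} (hm : xDualNorm c ≤ m) (hm0 : 0 ≤ m) :
    ∃ v ∈ convexHull ℝ (Set.range (monomialVec (n := n))), c = m • v := by
  by_contra hcon
  have hK : IsCompact (m • convexHull ℝ (Set.range (monomialVec (n := n)))) :=
    (isCompact_range continuous_monomialVec).isCompact_convexHull.smul m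
  have hcK : c ∉ m • convexHull ℝ (Set.range (monomialVec (n := n))) := by
    rintro ⟨v, hv, rfl⟩
    exact hcon ⟨v, hv, rfl⟩
  obtain ⟨f, s, hs, hsc⟩ := geometric_hahn_banach_closed_point
    ((convex_convexHull ℝ _).smul m) hK.isClosed hcK
  obtain ⟨u, hu, huf⟩ := exists_mem_VSa_pairing_eq f
  -- The separating functional is bounded by `s` on every scaled monomial vector, so its norm obeys
  -- the same bound, while its value at `c` exceeds `s`.
  have h1 : m * xNorm u ≤ s := by
    rw [xNorm, Real.mul_iSup_of_nonneg hm0]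
    refine ciSup_le fun α => ?_
    have := hs _ (Set.smul_mem_smul_set (subset_convexHull ℝ _ (Set.mem_range_self α)))
    rw [← huf _ (smul_mem_VSa _ (monomialVec_mem_VSa α)), pairing_smul_right] at this
    exact this.le
  have h2 := pairing_le_xDualNorm_mul_xNorm hn hu c
  have h0 : 0 ≤ xNorm u := (norm_nonneg _).trans (norm_apply_le_xNorm hn hu fun _ => 0)
  rw [huf c hc] at h2
  linarith [mul_le_mul_of_nonneg_right hm h0]

/-! ### The cone of separable states -/

theorem IsSeparable.zero : IsSeparable (0 : Matrix (Idx n) (Idx n) ℂ) :=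
  ⟨0, Fin.elim0, Fin.elim0, fun j => j.elim0, fun j => j.elim0, by simp⟩

theorem IsSeparable.add {ρ σ : Matrix (Idx n) (Idx n) ℂ} (hρ : IsSeparable ρ)
    (hσ : IsSeparable σ) : IsSeparable (ρ + σ) := by
  obtain ⟨l, p, x, hp, hx, rfl⟩ := hρ
  obtain ⟨m, q, y, hq, hy, rfl⟩ := hσ
  refine ⟨l + m, Fin.append p q, Fin.append x y, fun j => ?_, fun j => ?_, ?_⟩
  · refine Fin.addCases (fun j => ?_) (fun j => ?_) j <;> simp [hp, hq]
  · refine Fin.addCases (fun j => ?_) (fun j => ?_) j <;> simp [hx, hy]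
  · simp [Fin.sum_univ_add]

theorem IsSeparable.smul {ρ : Matrix (Idx n) (Idx n) ℂ} (hρ : IsSeparable ρ) {t : ℝ}
    (ht : 0 ≤ t) : IsSeparable (t • ρ) := by
  obtain ⟨l, p, x, hp, hx, rfl⟩ := hρ
  exact ⟨l, fun j => t * p j, x, fun j => mul_nonneg ht (hp j), hx, by
    simp [Finset.smul_sum, mul_smul]⟩

theorem IsSeparable.sum {ι : Type*} (s : Finset ι) {ρ : ι → Matrix (Idx n) (Idx n) ℂ}
    (h : ∀ j ∈ s, IsSeparable (ρ j)) : IsSeparable (∑ j ∈ s, ρ j) :=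
  Finset.sum_induction _ _ (fun _ _ => IsSeparable.add) .zero h

theorem isSeparable_productState {x : Fin n → EuclideanSpace ℂ (Fin 2)} (hx : ∀ k, ‖x k‖ = 1) :
    IsSeparable (productState x) :=
  ⟨1, fun _ => 1, fun _ => x, fun _ => zero_le_one, fun _ => hx, by simp⟩

theorem productState_apply (x : Fin n → EuclideanSpace ℂ (Fin 2)) (i j : Idx n) :
    productState x i j = ∏ k, x k (i k) * star (x k (j k)) := by
  simp [productState, Matrix.vecMulVec_apply, productVector, Finset.prod_mul_distrib]

/-! ### X-shaped matrices -/

theorem X_add (s t : Idx n → ℝ) (u v : Idx n → ℂ) : X (s + t) (u + v) = X s u + X t v := by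
  ext i j
  simp only [X, Matrix.of_apply, Matrix.add_apply, Pi.add_apply]
  split_ifs <;> simp

theorem X_smul (r : ℝ) (s : Idx n → ℝ) (u : Idx n → ℂ) : X (r • s) (r • u) = r • X s u := by
  ext i j
  simp only [X, Matrix.of_apply, Matrix.smul_apply, Pi.smul_apply]
  split_ifs <;> simp

theorem isSeparable_X_zero_right {s : Idx n → ℝ} (hs : s ∈ VPlus n) : IsSeparable (X s 0) := by
  have h : X s 0 = ∑ l : Idx n, s l • productState fun k => EuclideanSpace.single (l k) 1 := by
    ext i j
    have hl : ∀ l : Idx n, productState (fun k => EuclideanSpace.single (l k) (1 : ℂ)) i j =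
        if l = i ∧ j = i then 1 else 0 := by
      intro l
      rw [productState_apply]
      split_ifs with h
      · obtain ⟨rfl, rfl⟩ := h
        simp
      · have : ∃ k, ¬ (l k = i k ∧ j k = i k) := by
          by_contra! hk
          exact h ⟨funext fun k => (hk k).1, funext fun k => (hk k).2⟩
        obtain ⟨k, hk⟩ := this
        refine Finset.prod_eq_zero (Finset.mem_univ k) ?_
        by_cases h1 : i k = l k
        · have h2 : j k ≠ l k := fun h2 => hk ⟨h1.symm, h2.trans h1.symm⟩
          simp [h2]
        · simp [h1]
    rw [Matrix.sum_apply]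
    simp only [Matrix.smul_apply, hl]
    by_cases hij : j = i <;> simp [X, hij]
  rw [h]
  exact .sum _ fun l _ => (isSeparable_productState fun k => by simp).smul (hs l)

/-- The normalization of `(1, ± z⁻¹)`, the sign being determined by the digit `d`. -/
noncomputable def phaseVector (z : Circle) (d : Fin 2) : EuclideanSpace ℂ (Fin 2) :=
  ((√2)⁻¹ : ℝ) • !₂[1, (-1) ^ (d : ℕ) * ((z⁻¹ : Circle) : ℂ)]

theorem norm_phaseVector (z : Circle) (d : Fin 2) : ‖phaseVector z d‖ = 1 := by
  rw [phaseVector, norm_smul, EuclideanSpace.norm_eq]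
  simp [Circle.norm_coe, one_add_one_eq_two, abs_of_nonneg (Real.sqrt_nonneg 2)]

theorem phaseVector_mul_star (z : Circle) (d a b : Fin 2) :
    phaseVector z d a * star (phaseVector z d b) = (1 / 2) *
      (((-1) ^ (d : ℕ) * (z : ℂ)⁻¹) ^ (a : ℕ) * ((-1) ^ (d : ℕ) * (z : ℂ)) ^ (b : ℕ)) := by
  have hs : ((√2 : ℝ) : ℂ)⁻¹ * ((√2 : ℝ) : ℂ)⁻¹ = 1 / 2 := by
    rw [← mul_inv, ← Complex.ofReal_mul, Real.mul_self_sqrt zero_le_two]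
    norm_num
  have hz : star (z : ℂ)⁻¹ = z := by
    rw [← Circle.coe_inv, Circle.coe_inv_eq_conj]; exact Complex.conj_conj _
  have hv : ∀ a : Fin 2, phaseVector z d a =
      ((√2 : ℝ) : ℂ)⁻¹ * ((-1) ^ (d : ℕ) * ((z⁻¹ : Circle) : ℂ)) ^ (a : ℕ) := by
    intro a
    fin_cases a <;> simp [phaseVector]
  rw [hv, hv, ← hs]
  simp only [star_mul', star_pow, star_neg, star_one, Circle.coe_inv, hz]
  rw [show star ((√2 : ℝ) : ℂ)⁻¹ = ((√2 : ℝ) : ℂ)⁻¹ by simp]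
  ring

theorem phaseVector_add (z : Circle) (a b : Fin 2) :
    phaseVector z 0 a * star (phaseVector z 0 b) + phaseVector z 1 a * star (phaseVector z 1 b) =
      if b = a then 1 else 0 := by
  simp only [phaseVector_mul_star]
  have := z.coe_ne_zero
  fin_cases a <;> fin_cases b <;> simp [this] <;> norm_num

/-- The two signs agree on the diagonal and are opposite off it, so the difference of the
projections keeps only the antidiagonal, as their sum keeps only the diagonal. -/
theorem phaseVector_sub (z : Circle) (a b : Fin 2) :
    phaseVector z 0 a * star (phaseVector z 0 b) + -(phaseVector z 1 a * star (phaseVector z 1 b)) =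
      if b = a + 1 then ((z ^ (1 - 2 * ((a : ℕ) : ℤ)) : Circle) : ℂ) else 0 := by
  simp only [phaseVector_mul_star]
  have := z.coe_ne_zero
  fin_cases a <;> fin_cases b <;> simp [this] <;> ring

theorem prod_ite_eq_ite {ι β R : Type*} [Fintype ι] [DecidableEq β] [CommMonoidWithZero R]
    (i j : ι → β) (f : ι → R) [Decidable (j = i)] :
    ∏ k, (if j k = i k then f k else 0) = if j = i then ∏ k, f k else 0 := by
  split_ifs with h
  · simp [h]
  · obtain ⟨k, hk⟩ := Function.ne_iff.1 h
    exact Finset.prod_eq_zero (Finset.mem_univ k) (if_neg hk)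

/-- The X-shaped matrix of a monomial vector is obtained from one product vector by averaging over
sign changes. -/
theorem X_one_monomialVec (hn : 1 ≤ n) (α : Fin n → Circle) :
    X 1 (monomialVec α) = ∑ d : Idx n, (1 + ∏ k, (-1 : ℝ) ^ (d k : ℕ)) •
      productState fun k => phaseVector (α k) (d k) := by
  ext i j
  rw [Matrix.sum_apply]
  -- The unsigned sum over `d` gives the identity matrix, and the sum weighted by the product of
  -- signs gives the antidiagonal. The combined weight is `0` or `2`, hence nonnegative.
  have h1 := sum_prod_digits fun k b => phaseVector (α k) b (i k) * star (phaseVector (α k) b (j k))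
  have h2 := sum_prod_digits fun k b => (-1 : ℂ) ^ (b : ℕ) *
    (phaseVector (α k) b (i k) * star (phaseVector (α k) b (j k)))
  simp only [Fin.val_zero, Fin.val_one, pow_zero, pow_one, one_mul, neg_one_mul, phaseVector_sub,
    phaseVector_add] at h1 h2
  rw [prod_ite_eq_ite i j] at h1
  replace h2 := h2.trans (prod_ite_eq_ite (flip i) j _)
  rw [← monomialVec_apply] at h2
  have h3 : ∀ d : Idx n, ((1 + ∏ k, (-1 : ℝ) ^ (d k : ℕ)) •
      productState fun k => phaseVector (α k) (d k)) i j =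
      ∏ k, phaseVector (α k) (d k) (i k) * star (phaseVector (α k) (d k) (j k)) +
      ∏ k, (-1 : ℂ) ^ (d k : ℕ) *
        (phaseVector (α k) (d k) (i k) * star (phaseVector (α k) (d k) (j k))) := by
    intro d
    rw [Matrix.smul_apply, productState_apply, Complex.real_smul, Finset.prod_mul_distrib
      (f := fun k => (-1 : ℂ) ^ (d k : ℕ))]
    push_cast
    ring
  simp only [h3, Finset.sum_add_distrib, h1, h2, X, Matrix.of_apply]
  by_cases hij : j = i
  · have := flip_ne hn i
    subst hij
    simp [this.symm]
  · simp [hij]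

theorem isSeparable_X_one_monomialVec (hn : 1 ≤ n) (α : Fin n → Circle) :
    IsSeparable (X 1 (monomialVec α)) := by
  rw [X_one_monomialVec hn]
  refine .sum _ fun d _ => (isSeparable_productState fun k => norm_phaseVector _ _).smul ?_
  have h : |∏ k, (-1 : ℝ) ^ (d k : ℕ)| = 1 := by simp [Finset.abs_prod]
  linarith [neg_abs_le (∏ k, (-1 : ℝ) ^ (d k : ℕ))]

theorem isSeparable_X_one_of_mem_convexHull (hn : 1 ≤ n) {v : Idx n → ℂ}
    (hv : v ∈ convexHull ℝ (Set.range (monomialVec (n := n)))) : IsSeparable (X 1 v) := by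
  refine convexHull_min (t := {v | IsSeparable (X 1 v)}) ?_ ?_ hv
  · rintro _ ⟨α, rfl⟩
    exact isSeparable_X_one_monomialVec hn α
  · intro v hv w hw s t hs ht hst
    have h : (1 : Idx n → ℝ) = s • 1 + t • 1 := by rw [← add_smul, hst, one_smul]
    rw [Set.mem_ofPred_eq, h, X_add, X_smul, X_smul]
    exact (IsSeparable.smul hv hs).add (IsSeparable.smul hw ht)

theorem isSeparable_X_of_xDualNorm_le (hn : 1 ≤ n) {a : Idx n → ℝ} {c : Idx n → ℂ}
    (hc : c ∈ VSa n) {m : ℝ} (hm0 : 0 ≤ m) (hma : ∀ i, m ≤ a i) (hm : xDualNorm c ≤ m) :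
    IsSeparable (X a c) := by
  obtain ⟨v, hv, rfl⟩ := exists_mem_convexHull_of_xDualNorm_le hn hc hm hm0
  -- The diagonal in excess of `m` is split off as a diagonal state.
  have h : X a (m • v) = m • X 1 v + X (a - m • 1) 0 := by
    rw [← X_smul, ← X_add, add_zero, add_sub_cancel]
  rw [h]
  exact ((isSeparable_X_one_of_mem_convexHull hn hv).smul hm0).add
    (isSeparable_X_zero_right fun i => by simpa using hma i)

/-! ### The necessary condition -/

theorem exists_circle_mul_norm (z : ℂ) : ∃ w : Circle, z = ‖z‖ * (w : ℂ) :=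
  ⟨Circle.exp z.arg, by rw [Circle.coe_exp, Complex.norm_mul_exp_arg_mul_I]⟩

/-- The antidiagonal of a product state is a multiple of a monomial vector, and the factor is the
geometric mean of any two diagonal entries in opposite positions. -/
theorem exists_productState_flip_eq (x : Fin n → EuclideanSpace ℂ (Fin 2)) :
    ∃ (r : ℝ) (α : Fin n → Circle), 0 ≤ r ∧
      (∀ i, productState x i (flip i) = (r • monomialVec α) i) ∧
      ∀ i, r ≤ ((productState x i i).re + (productState x (flip i) (flip i)).re) / 2 := by
  choose α hα using fun k => exists_circle_mul_norm (x k 0 * star (x k 1))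
  refine ⟨∏ k, ‖x k 0‖ * ‖x k 1‖, α, by positivity, fun i => ?_, fun i => ?_⟩
  · rw [productState_apply, Pi.smul_apply, monomialVec_apply, Complex.real_smul, Complex.ofReal_prod,
      ← Finset.prod_mul_distrib]
    refine Finset.prod_congr rfl fun k _ => ?_
    have h0 := hα k
    rw [norm_mul, norm_star] at h0
    have h1 := congrArg star h0
    have key : ∀ b : Fin 2, x k b * star (x k (b + 1)) = ((‖x k 0‖ * ‖x k 1‖ : ℝ) : ℂ) *
        ((α k ^ (1 - 2 * ((b : ℕ) : ℤ)) : Circle) : ℂ) := by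
      intro b
      fin_cases b
      · simpa using h0
      · have hz : (starRingEnd ℂ) (α k : ℂ) = (α k : ℂ)⁻¹ := by
          rw [← Circle.coe_inv_eq_conj, Circle.coe_inv]
        simpa [hz, mul_comm] using h1
    exact key (i k)
  · have hd : ∀ j, (productState x j j).re = (∏ k, ‖x k (j k)‖) ^ 2 := by
      intro j
      have : productState x j j = ((∏ k, ‖x k (j k)‖) ^ 2 : ℝ) := by
        rw [productState_apply, ← Finset.prod_pow, Complex.ofReal_prod]
        refine Finset.prod_congr rfl fun k _ => ?_
        push_cast
        exact Complex.mul_conj' _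
      rw [this, Complex.ofReal_re]
    have hr : ∏ k, ‖x k 0‖ * ‖x k 1‖ = (∏ k, ‖x k (i k)‖) * ∏ k, ‖x k (flip i k)‖ := by
      rw [← Finset.prod_mul_distrib]
      refine Finset.prod_congr rfl fun k _ => ?_
      have key : ∀ b : Fin 2, ‖x k 0‖ * ‖x k 1‖ = ‖x k b‖ * ‖x k (b + 1)‖ := by
        intro b
        fin_cases b
        · rfl
        · exact mul_comm _ _
      exact key (i k)
    rw [hd, hd, hr]
    linarith [two_mul_le_add_sq (∏ k, ‖x k (i k)‖) (∏ k, ‖x k (flip i k)‖)]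

/-- Only diagonal and antidiagonal entries of the decomposition are compared, so the product states
need not be X-shaped themselves. -/
theorem pairing_le_of_isSeparable {a : Idx n → ℝ} {c : Idx n → ℂ} (hn : 1 ≤ n)
    (h : IsSeparable (X a c)) {u : Idx n → ℂ} (hu : xNorm u = 1) (i : Idx n) :
    pairing u c ≤ (a i + a (flip i)) / 2 := by
  obtain ⟨m, p, x, hp, -, hX⟩ := h
  choose r α hr hflip hle using fun j => exists_productState_flip_eq (x j)
  have hc : c = ∑ j, (p j * r j) • monomialVec (α j) := by
    funext l
    have := congrFun (congrFun hX l) (flip l)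
    rw [Matrix.sum_apply] at this
    simpa [X, flip_ne hn, hflip, mul_assoc] using this
  have ha : ∀ l, a l = ∑ j, p j * (productState (x j) l l).re := by
    intro l
    have := congrArg Complex.re (congrFun (congrFun hX l) l)
    rw [Matrix.sum_apply] at this
    simpa [X] using this
  have hpair : pairing u c = ∑ j, p j * r j * pairing u (monomialVec (α j)) := by
    simp only [← pairing_smul_right]
    rw [hc]
    simp only [pairing, Finset.sum_apply, Finset.mul_sum, ← Complex.re_sum]
    rw [Finset.sum_comm]
  rw [hpair, ha i, ha (flip i), ← Finset.sum_add_distrib, Finset.sum_div]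
  refine Finset.sum_le_sum fun j _ => ?_
  calc p j * r j * pairing u (monomialVec (α j)) ≤ p j * r j :=
        mul_le_of_le_one_right (mul_nonneg (hp j) (hr j))
          (hu ▸ pairing_monomialVec_le_xNorm u (α j))
    _ ≤ p j * (((productState (x j) i i).re + (productState (x j) (flip i) (flip i)).re) / 2) :=
        mul_le_mul_of_nonneg_left (hle j i) (hp j)
    _ = _ := by ring

end MultiQubit

theorem corollary4p6 (n : ℕ) (hn : 1 ≤ n)
    (a : MultiQubit.Idx n → ℝ) (c : MultiQubit.Idx n → ℂ)
    (ha : a ∈ MultiQubit.VPlus n) (hc : c ∈ MultiQubit.VSa n)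
    (hstate : MultiQubit.IsState (MultiQubit.X a c))
    (hsymm : ∀ i, a i = a (MultiQubit.flip i)) :
    MultiQubit.IsSeparable (MultiQubit.X a c) ↔
      MultiQubit.xDualNorm c ≤ Finset.univ.inf' Finset.univ_nonempty a := by
  constructor
  · intro h
    -- `Real.sSup_le` also asks for `0 ≤ a i`, since the supremum of the empty set is `0` by
    -- convention.
    refine Finset.le_inf' _ _ fun i _ => Real.sSup_le ?_ (ha i)
    rintro _ ⟨u, -, hu, rfl⟩
    have := MultiQubit.pairing_le_of_isSeparable hn h hu i
    rw [← hsymm i] at this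
    linarith
  · exact MultiQubit.isSeparable_X_of_xDualNorm_le hn hc (Finset.le_inf' _ _ fun i _ => ha i)
      fun i => Finset.inf'_le a (Finset.mem_univ i)
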